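/- Let $F$ and $F'$ be non-Archimedean local fields with rings of integers $\mathcal{O}$, $\mathcal{O}'$ and maximal ideals $\wp$, $\wp'$, and suppose that the (finite) residue fields have the same cardinality, $|\mathcal{O}/\wp| = |\mathcal{O}'/\wp'|$. Put $\mathcal{O}_\ell = \mathcal{O}/\wp^\ell$ and $\mathcal{O}'_\ell = \mathcal{O}'/\wp'^\ell$. Then for every natural number $n$: 1. The complex group algebras $\mathbb{C}[\mathrm{GL}_n(\mathcal{O}_2)]$ and $\mathbb{C}[\mathrm{GL}_n(\mathcal{O}'_2)]$ are isomorphic as $\mathbb{C}$-algebras. 2. Equivalently, the groups $\mathrm{GL}_n(\mathcal{O}_2)$ and $\mathrm{GL}_n(\mathcal{O}'_2)$ have the same number and dimensions of irreducible complex representations: the sets $\mathrm{Irr}(\mathrm{GL}_n(\mathcal{O}_2))$ and $\mathrm{Irr}(\mathrm{GL}_n(\mathcal{O}'_2))$ of isomorphism classes of irreducible complex representations are finite, and there is a bijection between them that preserves dimensions. 3. For a partition $\lambda = (\ell_1, \dots, \ell_k)$ let $G_{\lambda,F} = \mathrm{Aut}_{\mathcal{O}}\big(\bigoplus_{i=1}^k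 \mathcal{O}_{\ell_i}\big)$. For $\lambda = (2, \dots, 2)$ ($n$ parts), $\mathbb{C}[G_{\lambda,F}]$ and $\mathbb{C}[G_{\lambda,F'}]$ are isomorphic as $\mathbb{C}$-algebras; that is, Onn's conjecture (the isomorphism type of $\mathbb{C}[G_{\lambda,F}]$ depends only on $\lambda$ and the cardinality of the residue field) holds for $\lambda = (2, \dots, 2)$. -/

import Mathlib

open scoped ValuativeRel MatrixGroups

/-- The ring `𝒪_ℓ = 𝒪 / ℘^ℓ`, where `𝒪` is the ring of integers of `F` and `℘` its maximal
ideal. -/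
abbrev TruncatedRing (F : Type*) [Field F] [ValuativeRel F] (l : ℕ) : Type _ :=
  𝒪[F] ⧸ (𝓂[F] ^ l)

/-- The finite `𝒪`-module `M_λ = ⨁ i, 𝒪 / ℘^(λ i)` of type `λ = (λ 0, …, λ (k - 1))`. -/
abbrev ModuleOfType (F : Type*) [Field F] [ValuativeRel F] {k : ℕ} (lam : Fin k → ℕ) : Type _ :=
  ∀ i : Fin k, TruncatedRing F (lam i)

/-- The group `G_λ = Aut_𝒪 (M_λ)` of `𝒪`-linear automorphisms of `M_λ`. -/
abbrev AutOfType (F : Type*) [Field F] [ValuativeRel F] {k : ℕ} (lam : Fin k → ℕ) : Type _ :=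
  ModuleOfType F lam ≃ₗ[𝒪[F]] ModuleOfType F lam

/-- A finite-dimensional irreducible complex representation of a group `G`. -/
structure ComplexIrrep (G : Type*) [Group G] where
  /-- The underlying vector space. -/
  V : Type
  [addCommGroup : AddCommGroup V]
  [module : Module ℂ V]
  [finiteDimensional : FiniteDimensional ℂ V]
  /-- The action of `G`. -/
  ρ : Representation ℂ G V
  irreducible : ρ.IsIrreducible

attribute [instance] ComplexIrrep.addCommGroup ComplexIrrep.module
  ComplexIrrep.finiteDimensional

/-- Isomorphism of irreducible representations. -/
instance ComplexIrrep.isoSetoid (G : Type*) [Group G] : Setoid (ComplexIrrep G) where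
  r π σ := Nonempty (π.ρ.Equiv σ.ρ)
  iseqv :=
    { refl := fun π => ⟨Representation.Equiv.refl π.ρ⟩
      symm := fun ⟨e⟩ => ⟨e.symm⟩
      trans := fun ⟨e⟩ ⟨f⟩ => ⟨e.trans f⟩ }

/-- `Irr(G)`: the set of isomorphism classes of irreducible complex representations of `G`. -/
def Irr (G : Type*) [Group G] : Type _ :=
  Quotient (ComplexIrrep.isoSetoid G)

/-- The dimension of (an isomorphism class of) an irreducible representation. -/
noncomputable def Irr.dim {G : Type*} [Group G] : Irr G → ℕ :=
  Quotient.lift (fun π : ComplexIrrep G => Module.finrank ℂ π.V)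
    (fun _ _ ⟨e⟩ => e.toLinearEquiv.finrank_eq)

/-! Write `R` for the ring of length two, `k` for its finite residue field and `ϖ` for the generator
of its maximal ideal. The kernel of `GL n R → GL n k` consists of the `1 + ϖ Y`, so it is abelian
and isomorphic to `Matrix n n k`. Once a nontrivial `ψ` on `k` is fixed, its characters are `Y ↦ ψ
(tr (A Y))`, indexed by matrices `A` over `k`, and `GL n R` permutes them through conjugation of `A`
by `GL n k`. This action involves `k` alone; only the extension could remember `R`.

It does not, because each such character extends to a linear character of its stabilizer
(`extendsToStabilizer`). Write `A = S + N` with `S` a power of `A`, semisimple, and `N` nilpotent.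
For `S`, diagonalized after a separable residue extension, the extension is a product of characters
of determinants of blocks. For `N`, put in 0/1 Jordan form, an entrywise section of `R → k`
preserves commutation with `N`, and its failure to be multiplicative is invisible to `ψ`, since a
nilpotent matrix has trace zero.

The extended characters assemble into a cocycle (`exists_cocycle`). Dividing by it turns the
elements `g e_A`, with `e_A` the idempotent of the character of `A`, into a basis multiplying as the
groupoid of `GL n k` acting on `Matrix n n k` (`IsMonomialSystem.unit_mul_unit`). The group algebra
is therefore the algebra of that groupoid, which depends on `k` and `n` only. Irreducible
representations and their dimensions are then read off from the algebra. -/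

section

/-! ### Rings of length two and their congruence kernels -/

open Matrix

/-- A surjection `r : R → k` onto a field whose kernel is generated by an element `ϖ` with
annihilator equal to that kernel: the abstract form of `𝒪 / ℘² → 𝒪 / ℘`. -/
structure IsLengthTwo {R k : Type*} [CommRing R] [Field k] (r : R →+* k) (ϖ : R) : Prop where
  surjective : Function.Surjective r
  map_eq_zero : r ϖ = 0
  mul_eq_zero_iff : ∀ x, ϖ * x = 0 ↔ r x = 0
  exists_eq_mul : ∀ x, r x = 0 → ∃ y, x = ϖ * y

theorem MonoidHom.exists_comp_eq_of_injective {A B : Type*} [CommGroup A] [CommGroup B] [Finite B]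
    (f : A →* B) (hf : Function.Injective f) (χ : A →* ℂˣ) :
    ∃ χ' : B →* ℂˣ, ∀ a, χ' (f a) = χ a := by
  obtain ⟨χ', hχ'⟩ := MonoidHom.domRestrict_surjective ℂ f.range
    (χ.comp (MonoidHom.ofInjective hf).symm.toMonoidHom)
  refine ⟨χ', fun a => ?_⟩
  have h := DFunLike.congr_fun hχ' (MonoidHom.ofInjective hf a)
  simpa [MonoidHom.ofInjective_apply] using h

theorem AddChar.exists_comp_eq_of_injective {A B : Type*} [AddCommGroup A] [AddCommGroup B]
    [Finite B] (f : A →+ B) (hf : Function.Injective f) (ψ : AddChar A ℂ) :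
    ∃ ψ' : AddChar B ℂ, ∀ a, ψ' (f a) = ψ a := by
  obtain ⟨χ, hχ⟩ := MonoidHom.exists_comp_eq_of_injective (AddMonoidHom.toMultiplicative f) hf
    (MonoidHom.toHomUnits ψ.toMonoidHom)
  refine ⟨AddChar.toMonoidHomEquiv.symm ((Units.coeHom ℂ).comp χ), fun a => ?_⟩
  have h := congrArg Units.val (hχ (Multiplicative.ofAdd a))
  simpa using h

namespace IsLengthTwo

variable {R k : Type*} [CommRing R] [Field k] {r : R →+* k} {ϖ : R}

theorem sq_eq_zero (h : IsLengthTwo r ϖ) : ϖ * ϖ = 0 := (h.mul_eq_zero_iff _).2 h.map_eq_zero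

theorem mul_eq_mul_iff (h : IsLengthTwo r ϖ) (x y : R) : ϖ * x = ϖ * y ↔ r x = r y := by
  rw [← sub_eq_zero, ← mul_sub, h.mul_eq_zero_iff, map_sub, sub_eq_zero]

theorem isUnit_iff (h : IsLengthTwo r ϖ) (x : R) : IsUnit x ↔ r x ≠ 0 := by
  refine ⟨fun hx => (hx.map r).ne_zero, fun hx => ?_⟩
  obtain ⟨y, hy⟩ := h.surjective (r x)⁻¹
  obtain ⟨z, hz⟩ := h.exists_eq_mul (x * y - 1) (by simp [hy, hx])
  refine IsUnit.of_mul_eq_one (y * (1 - ϖ * z)) ?_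
  linear_combination (1 - ϖ * z) * hz - z * z * h.sq_eq_zero

/-- The isomorphism `x ↦ 1 + ϖ x` of `k` onto the units congruent to `1`. -/
noncomputable def oneAddHom (h : IsLengthTwo r ϖ) : Multiplicative k →* Rˣ :=
  MonoidHom.toHomUnits
    { toFun := fun x => 1 + ϖ * Function.surjInv h.surjective x.toAdd
      map_one' := by
        simpa [h.mul_eq_zero_iff] using Function.surjInv_eq h.surjective 0
      map_mul' := fun x y => by
        have h1 := (h.mul_eq_mul_iff (Function.surjInv h.surjective (x * y).toAdd)
          (Function.surjInv h.surjective x.toAdd + Function.surjInv h.surjective y.toAdd)).2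
          (by simp [Function.surjInv_eq])
        linear_combination h1 - Function.surjInv h.surjective x.toAdd *
          Function.surjInv h.surjective y.toAdd * h.sq_eq_zero }

theorem coe_oneAddHom (h : IsLengthTwo r ϖ) (x : R) :
    (h.oneAddHom (Multiplicative.ofAdd (r x)) : R) = 1 + ϖ * x := by
  simp [oneAddHom, h.mul_eq_mul_iff, Function.surjInv_eq]

theorem oneAddHom_injective (h : IsLengthTwo r ϖ) : Function.Injective h.oneAddHom := by
  intro x y hxy
  obtain ⟨a, ha⟩ := h.surjective x.toAdd
  obtain ⟨b, hb⟩ := h.surjective y.toAdd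
  have h1 := congrArg Units.val hxy
  rw [show x = Multiplicative.ofAdd (r a) from congrArg Multiplicative.ofAdd ha.symm,
    show y = Multiplicative.ofAdd (r b) from congrArg Multiplicative.ofAdd hb.symm,
    coe_oneAddHom, coe_oneAddHom, add_right_inj, h.mul_eq_mul_iff, ha, hb] at h1
  exact h1

/-- Characters of a subgroup of a finite abelian group extend to the whole group; here the subgroup
is that of the units congruent to `1`, a copy of `k`. -/
theorem exists_mulChar [Finite R] (h : IsLengthTwo r ϖ) (ψ : AddChar k ℂ) :
    ∃ θ : MulChar R ℂ, ∀ x, θ (1 + ϖ * x) = ψ (r x) := by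
  obtain ⟨χ, hχ⟩ := MonoidHom.exists_comp_eq_of_injective h.oneAddHom h.oneAddHom_injective
    (MonoidHom.toHomUnits ψ.toMonoidHom)
  refine ⟨MulChar.ofUnitHom χ, fun x => ?_⟩
  rw [← h.coe_oneAddHom, MulChar.ofUnitHom_coe, hχ]
  simp

theorem finite (h : IsLengthTwo r ϖ) [Finite k] : Finite R := by
  refine Finite.of_surjective (fun p : k × k => Function.surjInv h.surjective p.1 +
    ϖ * Function.surjInv h.surjective p.2) fun x => ?_
  obtain ⟨y, hy⟩ := h.exists_eq_mul (x - Function.surjInv h.surjective (r x))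
    (by simp [Function.surjInv_eq])
  refine ⟨(r x, r y), ?_⟩
  have := (h.mul_eq_mul_iff (Function.surjInv h.surjective (r y)) y).2
    (Function.surjInv_eq _ _)
  linear_combination this - hy

variable {n : Type*} [Fintype n] [DecidableEq n]

theorem det_one_add_smul (h : IsLengthTwo r ϖ) (Y : Matrix n n R) :
    (1 + ϖ • Y).det = 1 + ϖ * Y.trace := by
  rw [Matrix.det_one_add_smul]
  linear_combination
    (Polynomial.eval ϖ (1 + (Polynomial.X : Polynomial R) • Y.map Polynomial.C).det.divX.divX) * h.sq_eq_zero

theorem smul_eq_zero_iff (h : IsLengthTwo r ϖ) (Y : Matrix n n R) :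
    ϖ • Y = 0 ↔ r.mapMatrix Y = 0 := by
  simp [← Matrix.ext_iff, h.mul_eq_zero_iff]

theorem smul_eq_smul_iff (h : IsLengthTwo r ϖ) (Y Z : Matrix n n R) :
    ϖ • Y = ϖ • Z ↔ r.mapMatrix Y = r.mapMatrix Z := by
  rw [← sub_eq_zero, ← smul_sub, h.smul_eq_zero_iff, map_sub, sub_eq_zero]

theorem exists_eq_smul (h : IsLengthTwo r ϖ) (Y : Matrix n n R) (hY : r.mapMatrix Y = 0) :
    ∃ Z, Y = ϖ • Z := by
  choose f hf using fun i j => h.exists_eq_mul (Y i j) (congrFun (congrFun hY i) j)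
  exact ⟨Matrix.of f, Matrix.ext fun i j => by simpa using hf i j⟩

theorem mapMatrix_surjective (h : IsLengthTwo r ϖ) (X : Matrix n n k) :
    ∃ Y, r.mapMatrix Y = X := by
  choose f hf using fun i j => h.surjective (X i j)
  exact ⟨Matrix.of f, Matrix.ext fun i j => by simpa using hf i j⟩

theorem isUnit_matrix_iff (h : IsLengthTwo r ϖ) (Y : Matrix n n R) :
    IsUnit Y ↔ IsUnit (r.mapMatrix Y) := by
  rw [Matrix.isUnit_iff_isUnit_det, Matrix.isUnit_iff_isUnit_det, h.isUnit_iff, ← RingHom.map_det,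
    isUnit_iff_ne_zero]

theorem exists_general_linear_lift (h : IsLengthTwo r ϖ) (X : GL n k) :
    ∃ g : GL n R, r.mapMatrix (g : Matrix n n R) = X := by
  obtain ⟨Y, hY⟩ := h.mapMatrix_surjective (X : Matrix n n k)
  obtain ⟨g, rfl⟩ := (h.isUnit_matrix_iff Y).2 (hY ▸ X.isUnit)
  exact ⟨g, hY⟩

theorem exists_general_linear_one_add (h : IsLengthTwo r ϖ) (Y : Matrix n n R) :
    ∃ g : GL n R, (g : Matrix n n R) = 1 + ϖ • Y := by
  obtain ⟨g, hg⟩ := (h.isUnit_matrix_iff (1 + ϖ • Y)).2 (by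
    rw [map_add, (h.smul_eq_zero_iff (ϖ • Y)).1 (by rw [smul_smul, h.sq_eq_zero, zero_smul])]
    simp)
  exact ⟨g, hg⟩

theorem mapMatrix_smul (h : IsLengthTwo r ϖ) (Y : Matrix n n R) : r.mapMatrix (ϖ • Y) = 0 :=
  (h.smul_eq_zero_iff (ϖ • Y)).1 (by rw [smul_smul, h.sq_eq_zero, zero_smul])

theorem one_add_smul_mul (h : IsLengthTwo r ϖ) (Y Z : Matrix n n R) :
    (1 + ϖ • Y) * (1 + ϖ • Z) = 1 + ϖ • (Y + Z) := by
  have : (ϖ • Y) * (ϖ • Z) = 0 := by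
    rw [smul_mul_smul_comm, h.sq_eq_zero, zero_smul]
  rw [add_mul, mul_add, mul_add, this, smul_add]
  simp only [mul_one, one_mul]
  abel

end IsLengthTwo

/-! ### Extending characters of the congruence kernel to their stabilizers -/

section Extension

variable {R k : Type*} [CommRing R] [Field k] {r : R →+* k} {ϖ : R}
  {n : Type*} [Fintype n] [DecidableEq n]

/-- The character `1 + ϖ Y ↦ ψ (tr (A Y))` of the congruence kernel extends to a linear character
of its stabilizer, the preimage in `GL n R` of the centralizer of `A`. -/
def ExtendsToStabilizer (r : R →+* k) (ϖ : R) (ψ : AddChar k ℂ) (A : Matrix n n k) : Prop :=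
  ∃ χ : GL n R → ℂ,
    (∀ g h : GL n R, Commute (r.mapMatrix (g : Matrix n n R)) A →
      Commute (r.mapMatrix (h : Matrix n n R)) A → χ (g * h) = χ g * χ h) ∧
    ∀ (g : GL n R) (Y : Matrix n n R), (g : Matrix n n R) = 1 + ϖ • Y →
      χ g = ψ (A * r.mapMatrix Y).trace

theorem Commute.conj_of_mul_eq_one {M : Type*} [Monoid M] {x a p q : M} (hqp : q * p = 1)
    (h : Commute x a) : Commute (p * x * q) (p * a * q) := by
  have key : ∀ y z : M, (p * y * q) * (p * z * q) = p * (y * z) * q := fun y z => by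
    rw [mul_assoc (p * y), ← mul_assoc q, ← mul_assoc q, hqp, one_mul]
    simp only [mul_assoc]
  rw [Commute, SemiconjBy, key, key, h.eq]

theorem ExtendsToStabilizer.of_conj (h : IsLengthTwo r ϖ) {ψ : AddChar k ℂ} {A B : Matrix n n k}
    (P : GL n k) (hP : P * A = B * P) (hB : ExtendsToStabilizer r ϖ ψ B) :
    ExtendsToStabilizer r ϖ ψ A := by
  obtain ⟨χ, hmul, hχ⟩ := hB
  obtain ⟨Q, hQ⟩ := h.exists_general_linear_lift P
  obtain ⟨p, hp⟩ : ∃ p : Matrix n n k, p = P := ⟨_, rfl⟩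
  obtain ⟨p', hp'⟩ : ∃ p' : Matrix n n k, p' = r.mapMatrix ((Q⁻¹ : GL n R) : Matrix n n R) :=
    ⟨_, rfl⟩
  have hpp : p * p' = 1 := by
    rw [hp, hp', ← hQ, ← map_mul, Units.mul_inv, map_one]
  have hpp' : p' * p = 1 := by
    rw [hp, hp', ← hQ, ← map_mul, Units.inv_mul, map_one]
  rw [← hp] at hQ hP
  have hBA : B = p * A * p' := by rw [hP, mul_assoc, hpp, mul_one]
  refine ⟨fun g => χ (Q * g * Q⁻¹), fun g g' hg hg' => ?_, fun g Y hg => ?_⟩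
  · beta_reduce
    rw [← hmul _ _ ?_ ?_]
    · congr 1
      group
    · rw [Units.val_mul, Units.val_mul, map_mul, map_mul, hQ, ← hp', hBA]
      exact hg.conj_of_mul_eq_one hpp'
    · rw [Units.val_mul, Units.val_mul, map_mul, map_mul, hQ, ← hp', hBA]
      exact hg'.conj_of_mul_eq_one hpp'
  · beta_reduce
    rw [hχ (Q * g * Q⁻¹) (Q * Y * (Q⁻¹ : GL n R))]
    · rw [map_mul, map_mul, hQ, ← hp', hBA]
      congr 1
      have key : ∀ X : Matrix n n k, p * A * p' * (p * X * p') = p * (A * X * p') := fun X => by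
        rw [mul_assoc (p * A), ← mul_assoc p', ← mul_assoc p', hpp', one_mul]
        simp only [mul_assoc]
      rw [key, Matrix.trace_mul_comm, mul_assoc, hpp', mul_one]
    · rw [Units.val_mul, Units.val_mul, hg, mul_add, add_mul, mul_one, Units.mul_inv,
        mul_smul_comm, smul_mul_assoc]

theorem ExtendsToStabilizer.of_baseChange {R' l : Type*} [CommRing R'] [Field l] {r' : R' →+* l}
    {ψ : AddChar k ℂ} {ψ' : AddChar l ℂ} (i : R →+* R') (j : k →+* l)
    (hij : ∀ x, r' (i x) = j (r x)) (hψ : ∀ x, ψ' (j x) = ψ x) {A : Matrix n n k}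
    (hA : ExtendsToStabilizer r' (i ϖ) ψ' (j.mapMatrix A)) : ExtendsToStabilizer r ϖ ψ A := by
  obtain ⟨χ, hmul, hχ⟩ := hA
  have hr : ∀ Y : Matrix n n R, r'.mapMatrix (i.mapMatrix Y) = j.mapMatrix (r.mapMatrix Y) :=
    fun Y => Matrix.ext fun a b => hij _
  refine ⟨fun g => χ (GeneralLinearGroup.map i g), fun g g' hg hg' => ?_, fun g Y hg => ?_⟩
  · beta_reduce
    rw [map_mul]
    refine hmul _ _ ?_ ?_
    · have := hg.map j.mapMatrix
      rwa [← hr] at this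
    · have := hg'.map j.mapMatrix
      rwa [← hr] at this
  · beta_reduce
    rw [hχ _ (i.mapMatrix Y), hr, ← map_mul, ← hψ]
    · congr 1
      exact (AddMonoidHom.map_trace j.toAddMonoidHom _).symm
    · change i.mapMatrix (g : Matrix n n R) = _
      rw [hg, map_add, map_one]
      congr 1
      ext a b
      simp

/-- If the centralizer of the sum centralizes both summands, the product of the two extensions is
multiplicative on it. Intended for the Jordan decomposition. -/
theorem ExtendsToStabilizer.add {ψ : AddChar k ℂ} {A B : Matrix n n k}
    (hA : ExtendsToStabilizer r ϖ ψ A) (hB : ExtendsToStabilizer r ϖ ψ B)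
    (hAB : ∀ X : Matrix n n k, Commute X (A + B) → Commute X A) :
    ExtendsToStabilizer r ϖ ψ (A + B) := by
  obtain ⟨χ, hmul, hχ⟩ := hA
  obtain ⟨χ', hmul', hχ'⟩ := hB
  have hB' : ∀ X : Matrix n n k, Commute X (A + B) → Commute X B := fun X hX => by
    simpa using hX.sub_right (hAB X hX)
  refine ⟨fun g => χ g * χ' g, fun g g' hg hg' => ?_, fun g Y hg => ?_⟩
  · beta_reduce
    rw [hmul _ _ (hAB _ hg) (hAB _ hg'), hmul' _ _ (hB' _ hg) (hB' _ hg')]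
    ring
  · beta_reduce
    rw [hχ _ _ hg, hχ' _ _ hg, add_mul, trace_add, AddChar.map_add_eq_mul]

theorem commute_diagonal_iff (X : Matrix n n k) (c : n → k) :
    Commute X (diagonal c) ↔ ∀ i j, c i ≠ c j → X i j = 0 := by
  rw [Commute, SemiconjBy, ← Matrix.ext_iff]
  refine forall₂_congr fun i j => ?_
  rw [mul_diagonal, diagonal_mul, mul_comm, ← sub_eq_zero, ← sub_mul, mul_eq_zero, sub_eq_zero,
    eq_comm, or_iff_not_imp_left]

/-- An element of the stabilizer is block diagonal modulo `ϖ`, the blocks being the fibres of `c`.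
Taking a diagonal block is multiplicative on such elements because `ϖ * ϖ = 0`, and the determinant
of a block `1 + ϖ Y` sees the trace of `Y`. -/
theorem ExtendsToStabilizer.diagonal [Finite R] [Finite k] (h : IsLengthTwo r ϖ) (ψ : AddChar k ℂ)
    (c : n → k) : ExtendsToStabilizer r ϖ ψ (diagonal c) := by
  classical
  have := Fintype.ofFinite k
  choose θ hθ using fun a : k => h.exists_mulChar
    (ψ.compAddMonoidHom (AddMonoidHom.mulLeft a))
  refine ⟨fun g => ∏ a, θ a ((g : Matrix n n R).toSquareBlock c a).det,
    fun g g' hg hg' => ?_, fun g Y hg => ?_⟩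
  · rw [← Finset.prod_mul_distrib]
    refine Finset.prod_congr rfl fun a _ => ?_
    rw [← map_mul, ← det_mul]
    congr 2
    ext ⟨i, hi⟩ ⟨j, hj⟩
    simp only [toSquareBlock_def, Matrix.of_apply, Units.val_mul, mul_apply]
    have := Finset.sum_subtype (F := inferInstance) (Finset.univ.filter (fun x => c x = a)) (p := fun x => c x = a)
      (by simp) (fun x => (g : Matrix n n R) i x * (g' : Matrix n n R) x j)
    rw [← this]
    symm
    -- A path through an index outside the block picks up two off-block entries, both multiples of
    -- `ϖ`, hence contributes zero.
    refine Finset.sum_subset (Finset.filter_subset _ _) fun x _ hx => ?_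
    have hx : c x ≠ a := by simpa using hx
    obtain ⟨y, hy⟩ := h.exists_eq_mul ((g : Matrix n n R) i x)
      ((commute_diagonal_iff _ c).1 hg i x (by rw [hi]; exact hx.symm))
    obtain ⟨z, hz⟩ := h.exists_eq_mul ((g' : Matrix n n R) x j)
      ((commute_diagonal_iff _ c).1 hg' x j (by rw [hj]; exact hx))
    rw [hy, hz]
    linear_combination y * z * h.sq_eq_zero
  · have hblock : ∀ a, (g : Matrix n n R).toSquareBlock c a = 1 + ϖ • Y.toSquareBlock c a := by
      intro a
      ext i j
      simp [toSquareBlock_def, hg, Matrix.one_apply, Subtype.ext_iff]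
    simp only [hblock, h.det_one_add_smul, hθ]
    rw [show (Matrix.diagonal c * r.mapMatrix Y).trace
      = ∑ a, a * r (Y.toSquareBlock c a).trace by
        simp only [trace, diag_apply, diagonal_mul, toSquareBlock_def, Matrix.of_apply, map_sum]
        rw [← Finset.sum_fiberwise Finset.univ c]
        refine Finset.sum_congr rfl fun a _ => ?_
        rw [Finset.mul_sum, Finset.sum_subtype (Finset.univ.filter (fun x => c x = a))
          (p := fun x => c x = a) (by simp)]
        refine Finset.sum_congr rfl fun x _ => ?_
        rw [x.2]; rfl]
    exact (map_sum ψ.toMonoidHom.toAdditive _ _).symm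

/-- Commuting with a partial permutation matrix only says that certain entries are equal to each
other or to zero. Any entrywise map fixing zero respects this, additive or not. -/
theorem mapMatrix_commute_toMatrix {S T : Type*} [CommRing S] [CommRing T] (s : S → T)
    (hs : s 0 = 0) (f : n ≃. n) {X : Matrix n n S} (hX : Commute X f.toMatrix) :
    Commute (X.map s) f.toMatrix := by
  have hX' := hX.eq
  rw [← Matrix.ext_iff] at hX'
  rw [Commute, SemiconjBy, ← Matrix.ext_iff]
  intro i j
  have := congrArg s (hX' i j)
  rw [PEquiv.toMatrix_mul_apply, PEquiv.mul_toMatrix_apply] at this ⊢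
  revert this
  cases f i <;> cases f.symm j <;> simp [hs]

/-- Let `t g` be the entrywise lift of the reduction of `g`, and write `g = (1 + ϖ X) t g`. The
extension is `g ↦ ψ (tr (f X))`. The defect `t g * t g' * (t (g g'))⁻¹ = 1 + ϖ Z` commutes with `f`,
so `f Z` is nilpotent and contributes trace zero. -/
theorem ExtendsToStabilizer.toMatrix (h : IsLengthTwo r ϖ) (ψ : AddChar k ℂ) (f : n ≃. n)
    (hf : IsNilpotent (f.toMatrix : Matrix n n k)) :
    ExtendsToStabilizer r ϖ ψ (f.toMatrix : Matrix n n k) := by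
  classical
  have hfr : r.mapMatrix (f.toMatrix : Matrix n n R) = f.toMatrix := by
    ext i j
    simp only [RingHom.mapMatrix_apply, map_apply, PEquiv.toMatrix_apply]
    split_ifs <;> simp
  -- `s 0 = 0` preserves commutation with `f`; together with `s 1 = 1` it makes `t` trivial on the
  -- congruence kernel.
  obtain ⟨s, hrs, hs0, hs1⟩ : ∃ s : k → R, (∀ x, r (s x) = x) ∧ s 0 = 0 ∧ s 1 = 1 := by
    refine ⟨fun x => if x = 0 then 0 else if x = 1 then 1 else Function.surjInv h.surjective x,
      fun x => ?_, by simp, by simp⟩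
    dsimp only
    split_ifs with h0 h1
    · simp [h0]
    · simp [h1]
    · exact Function.surjInv_eq _ _
  have hlift : ∀ X : Matrix n n k, r.mapMatrix (X.map s) = X := fun X => by
    ext i j
    simp [hrs]
  have ht : ∀ g : GL n R, ∃ u : GL n R,
      (u : Matrix n n R) = (r.mapMatrix (g : Matrix n n R)).map s := fun g =>
    (h.isUnit_matrix_iff _).2 (by rw [hlift]; exact g.isUnit.map r.mapMatrix)
  choose t ht using ht
  have hrt : ∀ g, r.mapMatrix (t g : Matrix n n R) = r.mapMatrix (g : Matrix n n R) := fun g => by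
    rw [ht, hlift]
  have htf : ∀ g : GL n R, Commute (r.mapMatrix (g : Matrix n n R)) f.toMatrix →
      Commute (t g : Matrix n n R) f.toMatrix := fun g hg => by
    rw [ht]
    exact mapMatrix_commute_toMatrix s hs0 f hg
  have hX : ∀ g : GL n R, ∃ X : Matrix n n R, (g : Matrix n n R) = (1 + ϖ • X) * t g := by
    intro g
    obtain ⟨Z, hZ⟩ := h.exists_eq_smul ((g : Matrix n n R) - (t g : Matrix n n R)) (by rw [map_sub, hrt, sub_self])
    refine ⟨Z * (((t g)⁻¹ : GL n R) : Matrix n n R), ?_⟩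
    rw [add_mul, one_mul, smul_mul_assoc, mul_assoc, Units.inv_mul, mul_one, ← hZ]
    abel
  choose X hX using hX
  have hunique : ∀ (g : GL n R) (Y : Matrix n n R), (g : Matrix n n R) = (1 + ϖ • Y) * t g →
      r.mapMatrix Y = r.mapMatrix (X g) := by
    intro g Y hY
    have := (t g).isUnit.mul_right_cancel (hY.symm.trans (hX g))
    exact (h.smul_eq_smul_iff _ _).1 (add_left_cancel this)
  refine ⟨fun g => ψ (f.toMatrix * r.mapMatrix (X g)).trace, fun g g' hg hg' => ?_,
    fun g Y hg => ?_⟩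
  · obtain ⟨g₀, hg₀⟩ : ∃ g₀ : GL n R, g₀ = t g * t g' * (t (g * g'))⁻¹ := ⟨_, rfl⟩
    have hrr : r.mapMatrix (t g * t g' : Matrix n n R) = r.mapMatrix (t (g * g') : Matrix n n R) := by
      rw [hrt, map_mul, hrt, hrt, Units.val_mul, map_mul]
    obtain ⟨Z, hZ⟩ : ∃ Z : Matrix n n R, (g₀ : Matrix n n R) = 1 + ϖ • Z := by
      obtain ⟨Z, hZ⟩ := h.exists_eq_smul ((g₀ : Matrix n n R) - 1) (by
        rw [hg₀, map_sub, Units.val_mul, Units.val_mul, map_mul, hrr, ← map_mul, Units.mul_inv,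
          sub_self])
      exact ⟨Z, by rw [← hZ]; abel⟩
    have hcomm : Commute (g₀ : Matrix n n R) f.toMatrix := by
      rw [hg₀, Units.val_mul, Units.val_mul]
      refine ((htf g hg).mul_left (htf g' hg')).mul_left (Commute.units_inv_left ?_)
      exact htf _ (by rw [Units.val_mul, map_mul]; exact hg.mul_left hg')
    have hZf : Commute (r.mapMatrix Z) f.toMatrix := by
      have h1 : Commute (ϖ • Z) f.toMatrix := by
        have := hcomm.sub_left (Commute.one_left f.toMatrix)
        rwa [hZ, add_sub_cancel_left] at this
      have h2 := h1.eq
      rw [smul_mul_assoc, mul_smul_comm, h.smul_eq_smul_iff, map_mul, map_mul, hfr] at h2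
      exact h2
    have htr : (f.toMatrix * r.mapMatrix Z).trace = 0 :=
      (Matrix.isNilpotent_trace_of_isNilpotent (hZf.symm.isNilpotent_mul_right hf)).eq_zero
    have hconj : r.mapMatrix (X (g * g')) = r.mapMatrix
        (X g + (t g : Matrix n n R) * X g' * (((t g)⁻¹ : GL n R) : Matrix n n R) + Z) := by
      symm
      apply hunique
      rw [← h.one_add_smul_mul, ← h.one_add_smul_mul, ← hZ, hg₀]
      have h1 : (1 + ϖ • ((t g : Matrix n n R) * X g' * ((t g)⁻¹ : GL n R)) : Matrix n n R) =
          t g * (1 + ϖ • X g') * ((t g)⁻¹ : GL n R) := by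
        rw [mul_add, add_mul, mul_one, Units.mul_inv, mul_smul_comm, smul_mul_assoc]
      have h2 : ((g * g' : GL n R) : Matrix n n R) =
          (1 + ϖ • X g) * t g * ((1 + ϖ • X g') * t g') := by
        rw [← hX, ← hX, Units.val_mul]
      rw [h1, h2, Units.val_mul, Units.val_mul]
      simp only [mul_assoc, Units.inv_mul, Units.inv_mul_cancel_left, mul_one]
    beta_reduce
    rw [hconj, map_add, map_add, mul_add, mul_add, trace_add, trace_add, htr, add_zero,
      AddChar.map_add_eq_mul]
    -- Conjugation by `t g` does not change the trace, since `t g` commutes with `f`.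
    have h3 : (f.toMatrix * r.mapMatrix (t g * X g' * ((t g)⁻¹ : GL n R) : Matrix n n R)).trace =
        (f.toMatrix * r.mapMatrix (X g')).trace := by
      have h4 := (htf g hg).eq
      rw [← hfr, ← map_mul, ← map_mul, ← mul_assoc, ← mul_assoc, ← h4, mul_assoc, mul_assoc,
        map_mul, Matrix.trace_mul_comm, ← map_mul, mul_assoc, mul_assoc, Units.inv_mul, mul_one]
    rw [h3]
  · beta_reduce
    rw [hunique g Y]
    have : (t g : Matrix n n R) = 1 := by
      rw [ht, hg, map_add, h.mapMatrix_smul, map_one, add_zero]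
      exact Matrix.map_one s hs0 hs1
    rw [this, mul_one, hg]

end Extension

/-! ### Normal forms: nilpotent and diagonalizable matrices -/

/-- The partial bijection `(i, j) ↦ (i, j + 1)` of a disjoint union of chains. -/
def chainShift {ι : Type*} (e : ι → ℕ) : (Σ i, Fin (e i)) ≃. (Σ i, Fin (e i)) where
  toFun x := if h : x.2.1 + 1 < e x.1 then some ⟨x.1, x.2.1 + 1, h⟩ else none
  invFun x := if 0 < x.2.1 then some ⟨x.1, x.2.1 - 1, by omega⟩ else none
  inv := by
    rintro ⟨i, a, ha⟩ ⟨j, b, hb⟩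
    simp only [Option.dite_none_right_eq_some, Option.ite_none_right_eq_some,
      Option.some.injEq, Sigma.mk.injEq]
    constructor
    · rintro ⟨h1, rfl, h2⟩
      simp only [heq_eq_eq, Fin.mk.injEq] at h2
      exact ⟨by omega, rfl, by simp only [heq_eq_eq, Fin.mk.injEq]; omega⟩
    · rintro ⟨h1, rfl, h2⟩
      simp only [heq_eq_eq, Fin.mk.injEq] at h2
      exact ⟨by omega, rfl, by simp only [heq_eq_eq, Fin.mk.injEq]; omega⟩

open Polynomial in
theorem exists_basis_pi_quotient_X_pow (k : Type*) [Field k] {d : ℕ} (e : Fin d → ℕ) :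
    ∃ b : Module.Basis (Σ i, Fin (e i)) k (Π i, k[X] ⧸ k[X] ∙ (X : k[X]) ^ e i),
      ∀ x, (X : k[X]) • b x = (chainShift e x).elim 0 b := by
  have hb : ∀ m : ℕ, ∃ c : Module.Basis (Fin m) k (k[X] ⧸ k[X] ∙ (X : k[X]) ^ m),
      ∀ j, c j = Submodule.Quotient.mk (X ^ (j : ℕ)) := fun m => by
    let pb : PowerBasis k (AdjoinRoot ((X : k[X]) ^ m)) := AdjoinRoot.powerBasis' (monic_X_pow m)
    have hdim : pb.dim = m := by simp [pb]
    have hpb : ∀ j, pb.basis.reindex (finCongr hdim) j = AdjoinRoot.mk _ (X ^ (j : ℕ)) := by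
      intro j
      rw [Module.Basis.reindex_apply, pb.basis_eq_pow]
      simp [pb]
    exact ⟨pb.basis.reindex (finCongr hdim), hpb⟩
  choose c hc using hb
  refine ⟨Pi.basis fun i => c (e i), ?_⟩
  rintro ⟨i, j⟩
  rw [Pi.basis_apply, ← Pi.single_smul, hc, ← Submodule.Quotient.mk_smul, smul_eq_mul, ← pow_succ']
  by_cases h : j.1 + 1 < e i
  · have : chainShift e ⟨i, j⟩ = some ⟨i, j.1 + 1, h⟩ := dif_pos h
    rw [this]
    simp [hc]
  · have : chainShift e ⟨i, j⟩ = none := dif_neg h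
    rw [this, show j.1 + 1 = e i by omega]
    have h0 : (Submodule.Quotient.mk (X ^ e i) : k[X] ⧸ k[X] ∙ (X : k[X]) ^ e i) = 0 :=
      (Submodule.Quotient.mk_eq_zero _).2 (Submodule.mem_span_singleton_self _)
    rw [h0]
    simp

-- Jordan form from the structure theorem: `V` with `X` acting as `N` is a finitely generated
-- `X`-power torsion `k[X]`-module, so a sum of quotients by powers of `X`.
open Polynomial in
theorem exists_basis_of_isNilpotent {k V : Type*} [Field k] [AddCommGroup V] [Module k V]
    [FiniteDimensional k V] (N : Module.End k V) (hN : IsNilpotent N) :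
    ∃ (d : ℕ) (e : Fin d → ℕ) (b : Module.Basis (Σ i, Fin (e i)) k V),
      ∀ x, N (b x) = (chainShift e x).elim 0 b := by
  obtain ⟨m, hm⟩ := hN
  have htors : Module.IsTorsion' (Module.AEval' N) (Submonoid.powers (X : k[X])) := by
    intro v
    refine ⟨⟨X ^ m, m, rfl⟩, ?_⟩
    obtain ⟨v, rfl⟩ := (Module.AEval'.of N).surjective v
    change (X ^ m : k[X]) • Module.AEval'.of N v = 0
    rw [Module.AEval'.X_pow_smul_of, hm]
    simp
  obtain ⟨d, e, ⟨φ⟩⟩ := Module.torsion_by_prime_power_decomposition Polynomial.irreducible_X htors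
  obtain ⟨b, hb⟩ := exists_basis_pi_quotient_X_pow k e
  let φ' := φ.trans (DirectSum.linearEquivFunOnFintype k[X] (Fin d) _)
  refine ⟨d, e, b.map ((φ'.symm.restrictScalars k).trans (Module.AEval'.of N).symm), fun x => ?_⟩
  simp only [Module.Basis.map_apply, LinearEquiv.trans_apply, LinearEquiv.restrictScalars_apply]
  apply (Module.AEval'.of N).injective
  rw [← Module.AEval'.X_smul_of, LinearEquiv.apply_symm_apply, ← map_smul, hb]
  cases chainShift e x <;> simp

theorem Matrix.exists_toMatrix_of_isNilpotent {k n : Type*} [Field k] [Fintype n] [DecidableEq n]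
    (N : Matrix n n k) (hN : IsNilpotent N) :
    ∃ (P : GL n k) (f : n ≃. n), P * N = (f.toMatrix : Matrix n n k) * P := by
  classical
  obtain ⟨d, e, b, hb⟩ := exists_basis_of_isNilpotent (Matrix.toLin' N) (hN.map Matrix.toLinAlgEquiv')
  let E : (Σ i, Fin (e i)) ≃ n := b.indexEquiv (Pi.basisFun k n)
  let g : n ≃. n := (E.symm.toPEquiv.trans (chainShift e)).trans E.toPEquiv
  let b' := b.reindex E
  have hb' : ∀ i, Matrix.toLin' N (b' i) = (g i).elim 0 b' := fun i => by
    simp only [b', Module.Basis.reindex_apply, hb, g, PEquiv.trans]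
    cases h : chainShift e (E.symm i) <;> simp [h, Equiv.toPEquiv]
  obtain ⟨Q, hQ⟩ : ∃ Q : GL n k, (Q : Matrix n n k) = (Pi.basisFun k n).toMatrix b' :=
    letI := (Pi.basisFun k n).invertibleToMatrix b'
    isUnit_of_invertible ((Pi.basisFun k n).toMatrix b')
  have hNQ : N * (Q : Matrix n n k) = (Q : Matrix n n k) * g.symm.toMatrix := by
    ext i j
    rw [PEquiv.mul_toMatrix_apply, PEquiv.symm_symm, hQ]
    have h1 := congrFun (hb' j) i
    rw [Matrix.toLin'_apply] at h1
    have h2 : (N * (Pi.basisFun k n).toMatrix b') i j = (N *ᵥ b' j) i := by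
      simp [Matrix.mul_apply, Matrix.mulVec, dotProduct, Module.Basis.toMatrix_apply]
    rw [h2, h1]
    cases g j <;> simp [Module.Basis.toMatrix_apply]
  -- Columns of the matrix are images of basis vectors, so its nonzero entries sit at `(g j, j)`:
  -- the inverse of `g` appears.
  refine ⟨Q⁻¹, g.symm, ?_⟩
  rw [← mul_one N, ← Units.mul_inv Q, ← mul_assoc N, hNQ, ← mul_assoc, ← mul_assoc,
    Units.inv_mul, one_mul]

open Polynomial in
theorem Module.End.ker_aeval_prod_X_sub_C_le {k V : Type*} [Field k] [AddCommGroup V] [Module k V]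
    (f : Module.End k V) (s : Finset k) :
    LinearMap.ker (aeval f (∏ a ∈ s, (X - C a))) ≤ ⨆ a, f.eigenspace a := by
  classical
  induction s using Finset.induction_on with
  | empty => simp [Module.End.one_eq_id]
  | insert a s ha ih =>
    rw [Finset.prod_insert ha, ← sup_ker_aeval_eq_ker_aeval_mul_of_coprime]
    · refine sup_le (le_trans (le_of_eq ?_) (le_iSup _ a)) ih
      rw [Module.End.eigenspace_def, map_sub, aeval_X, aeval_C, Algebra.algebraMap_eq_smul_one]
    · exact IsCoprime.prod_right fun b hb =>
        isCoprime_X_sub_C_of_isUnit_sub (sub_ne_zero.2 (by rintro rfl; exact ha hb)).isUnit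

theorem Matrix.exists_diagonal_of_iSup_eigenspace {k n : Type*} [Field k] [Fintype n]
    [DecidableEq n] (S : Matrix n n k) (hS : ⨆ a, Module.End.eigenspace (Matrix.toLin' S) a = ⊤) :
    ∃ (P : GL n k) (c : n → k), P * S = Matrix.diagonal c * P := by
  let E : Set (n → k) := {v | ∃ a, v ∈ Module.End.eigenspace (Matrix.toLin' S) a}
  have hE : ⊤ ≤ Submodule.span k E := by
    rw [← hS]
    exact iSup_le fun a v hv => Submodule.subset_span ⟨a, hv⟩
  let b₀ := Module.Basis.ofSpan hE
  let b := b₀.reindex (b₀.indexEquiv (Pi.basisFun k n))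
  have hb : ∀ i, ∃ a, Matrix.toLin' S (b i) = a • b i := fun i => by
    obtain ⟨a, ha⟩ : b i ∈ E := by
      refine Module.Basis.ofSpan_subset hE ⟨(b₀.indexEquiv (Pi.basisFun k n)).symm i, ?_⟩
      simp [b, b₀]
    exact ⟨a, Module.End.mem_eigenspace_iff.1 ha⟩
  choose c hc using hb
  obtain ⟨Q, hQ⟩ : ∃ Q : GL n k, (Q : Matrix n n k) = (Pi.basisFun k n).toMatrix b :=
    letI := (Pi.basisFun k n).invertibleToMatrix b
    isUnit_of_invertible ((Pi.basisFun k n).toMatrix b)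
  have hSQ : S * (Q : Matrix n n k) = (Q : Matrix n n k) * diagonal c := by
    ext i j
    rw [mul_diagonal, hQ]
    have h1 := congrFun (hc j) i
    rw [Matrix.toLin'_apply] at h1
    have h2 : (S * (Pi.basisFun k n).toMatrix b) i j = (S *ᵥ b j) i := by
      simp [Matrix.mul_apply, Matrix.mulVec, dotProduct, Module.Basis.toMatrix_apply]
    rw [h2, h1]
    simp [Module.Basis.toMatrix_apply, mul_comm]
  refine ⟨Q⁻¹, c, ?_⟩
  rw [← mul_one S, ← Units.mul_inv Q, ← mul_assoc S, hSQ, ← mul_assoc, ← mul_assoc,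
    Units.inv_mul, one_mul]

-- `S` is annihilated by a polynomial that is a product of distinct linear factors.
open Polynomial in
theorem Matrix.exists_diagonal_of_pow_eq {k n : Type*} [Field k] [Fintype n]
    [DecidableEq n] {q : ℕ} (hq : 1 < q) (hsep : (X ^ q - X : k[X]).Separable)
    (hsplit : (X ^ q - X : k[X]).Splits) (S : Matrix n n k) (hS : S ^ q = S) :
    ∃ (P : GL n k) (c : n → k), P * S = Matrix.diagonal c * P := by
  classical
  refine Matrix.exists_diagonal_of_iSup_eigenspace S (top_le_iff.1 ?_)
  have hmonic : (X ^ q - X : k[X]).Monic := by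
    apply monic_X_pow_sub; simpa using hq
  have hprod : (∏ a ∈ (X ^ q - X : k[X]).roots.toFinset, (X - C a)) = X ^ q - X := by
    conv_rhs => rw [hsplit.eq_prod_roots_of_monic hmonic]
    rw [Finset.prod_multiset_map_count]
    refine Finset.prod_congr rfl fun a ha => ?_
    rw [Multiset.count_eq_one_of_mem (nodup_roots hsep) (Multiset.mem_toFinset.1 ha), pow_one]
  refine le_trans (le_of_eq ?_) (Module.End.ker_aeval_prod_X_sub_C_le (Matrix.toLin' S)
    (X ^ q - X : k[X]).roots.toFinset)
  rw [hprod, eq_comm, LinearMap.ker_eq_top]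
  simp [← Matrix.toLin'_pow, hS]

/-! ### Base change of the residue field and the extension theorem -/

open Polynomial in
theorem IsLengthTwo.exists_baseChange {R : Type*} {k : Type*} [CommRing R] [Field k] {r : R →+* k}
    {ϖ : R} (h : IsLengthTwo r ϖ) (l : Type*) [Field l] [Algebra k l] [FiniteDimensional k l]
    [Algebra.IsSeparable k l] :
    ∃ (g : R[X]) (r' : AdjoinRoot g →+* l), IsLengthTwo r' (AdjoinRoot.of g ϖ) ∧
      ∀ x, r' (AdjoinRoot.of g x) = algebraMap k l (r x) := by
  obtain ⟨α, hα⟩ := Field.exists_primitive_element k l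
  -- Any lift of the minimal polynomial of a primitive element will do; it need not be monic.
  obtain ⟨g, hg⟩ := Polynomial.map_surjective r h.surjective (minpoly k α)
  have hint : IsIntegral k α := Algebra.IsIntegral.isIntegral α
  have hmap : ∀ p : R[X], eval₂ ((algebraMap k l).comp r) α p = aeval α (p.map r) := fun p => by
    rw [← eval₂_map, aeval_def]
  let r' : AdjoinRoot g →+* l := AdjoinRoot.lift ((algebraMap k l).comp r) α (by
    rw [hmap, hg, minpoly.aeval])
  have hr' : ∀ p : R[X], r' (AdjoinRoot.mk g p) = aeval α (p.map r) := fun p => by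
    rw [← hmap]; exact AdjoinRoot.lift_mk _ p
  have hC : ∀ p : R[X], p.map r = 0 → ∃ q, p = C ϖ * q := fun p hp => by
    refine (C_dvd_iff_dvd_coeff _ _).2 fun i => ?_
    obtain ⟨y, hy⟩ := h.exists_eq_mul (p.coeff i) (by rw [← coeff_map, hp, coeff_zero])
    exact ⟨y, hy⟩
  have hC' : ∀ p : R[X], C ϖ * p = 0 ↔ p.map r = 0 := fun p => by
    simp [Polynomial.ext_iff, h.mul_eq_zero_iff]
  have hker : ∀ p : R[X], r' (AdjoinRoot.mk g p) = 0 ↔ ∃ q, AdjoinRoot.mk g p =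
      AdjoinRoot.mk g (C ϖ * q) := fun p => by
    rw [hr', ← minpoly.dvd_iff]
    constructor
    · rintro ⟨m, hm⟩
      obtain ⟨m, rfl⟩ := Polynomial.map_surjective r h.surjective m
      obtain ⟨q, hq⟩ := hC (p - g * m) (by rw [Polynomial.map_sub, Polynomial.map_mul, hm, hg, sub_self])
      refine ⟨q, ?_⟩
      rw [← hq]
      simp
    · rintro ⟨q, hq⟩
      obtain ⟨m, hm⟩ := AdjoinRoot.mk_eq_mk.1 hq
      have h1 := congrArg (Polynomial.map r) hm
      rw [Polynomial.map_sub, Polynomial.map_mul, Polynomial.map_mul, map_C, h.map_eq_zero, hg,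
        C_0, zero_mul, sub_zero] at h1
      exact ⟨_, h1⟩
  refine ⟨g, r', ⟨fun y => ?_, ?_, fun x => ?_, fun x hx => ?_⟩, fun x => ?_⟩
  · have hy : y ∈ (IntermediateField.adjoin k {α}).toSubalgebra := by rw [hα]; trivial
    rw [IntermediateField.adjoin_simple_toSubalgebra_of_isAlgebraic hint.isAlgebraic,
      Algebra.adjoin_singleton_eq_range_aeval] at hy
    obtain ⟨p, rfl⟩ := hy
    obtain ⟨p, rfl⟩ := Polynomial.map_surjective r h.surjective p
    exact ⟨AdjoinRoot.mk g p, hr' p⟩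
  · rw [← AdjoinRoot.mk_C, hr']
    simp [h.map_eq_zero]
  · obtain ⟨p, rfl⟩ := AdjoinRoot.mk_surjective x
    rw [← AdjoinRoot.mk_C, ← map_mul]
    constructor
    · intro hp
      -- From `ϖ p = g m`, reduction gives `m = 0` modulo `ϖ`, as `g` reduces to a nonzero
      -- polynomial over a field. Thus `m = ϖ m'`, and `ϖ (p - g m') = 0` forces `p` and `g m'` to
      -- have the same reduction.
      obtain ⟨m, hm⟩ := AdjoinRoot.mk_eq_zero.1 hp
      have h1 := congrArg (Polynomial.map r) hm
      rw [Polynomial.map_mul, Polynomial.map_mul, map_C, h.map_eq_zero, hg, C_0, zero_mul, eq_comm,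
        mul_eq_zero, or_iff_right (minpoly.ne_zero hint)] at h1
      obtain ⟨m, rfl⟩ := hC m h1
      have h2 : C ϖ * (p - g * m) = 0 := by linear_combination hm
      rw [hC', Polynomial.map_sub, Polynomial.map_mul, hg, sub_eq_zero] at h2
      rw [hr', h2]
      simp
    · intro hp
      obtain ⟨q, hq⟩ := (hker p).1 hp
      rw [map_mul, hq, ← map_mul, ← mul_assoc, ← C_mul, h.sq_eq_zero]
      simp
  · obtain ⟨p, rfl⟩ := AdjoinRoot.mk_surjective x
    obtain ⟨q, hq⟩ := (hker p).1 hx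
    exact ⟨AdjoinRoot.mk g q, by rw [hq, map_mul, AdjoinRoot.mk_C]⟩
  · rw [← AdjoinRoot.mk_C, hr']
    simp

theorem exists_pow_expChar_pow_eq {M : Type*} [Monoid M] [Finite M] (p : ℕ) (x : M) :
    ∃ a, 0 < a ∧ (x ^ p ^ a) ^ p ^ a = x ^ p ^ a := by
  obtain ⟨i, j, hij, heq⟩ : ∃ i j : ℕ, i < j ∧ x ^ p ^ i = x ^ p ^ j := by
    obtain ⟨i, j, hne, heq⟩ := Finite.exists_ne_map_eq_of_infinite fun i : ℕ => x ^ p ^ i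
    rcases lt_or_gt_of_ne hne with h | h
    · exact ⟨i, j, h, heq⟩
    · exact ⟨j, i, h, heq.symm⟩
  obtain ⟨d, hd, rfl⟩ := Nat.exists_eq_add_of_lt hij
  have hstep : ∀ m, i ≤ m → x ^ p ^ (m + (d + 1)) = x ^ p ^ m := fun m hm => by
    obtain ⟨c, rfl⟩ := Nat.exists_eq_add_of_le hm
    rw [add_right_comm, pow_add p _ c, pow_mul, ← add_assoc i d 1, ← heq, ← pow_mul, ← pow_add]
  have hsteps : ∀ t m, i ≤ m → x ^ p ^ (m + t * (d + 1)) = x ^ p ^ m := by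
    intro t
    induction t with
    | zero => simp
    | succ t ih =>
      intro m hm
      rw [add_mul, one_mul, ← add_assoc, hstep _ (hm.trans (Nat.le_add_right _ _)), ih m hm]
  -- The sequence `x ^ p ^ m` has period `d + 1` from `m = i` on; the exponent must be a positive
  -- multiple of the period and at least `i`.
  refine ⟨(i + 1) * (d + 1), by positivity, ?_⟩
  rw [← pow_mul, ← pow_add]
  exact hsteps (i + 1) _ (by nlinarith)

-- The Jordan decomposition is `S = A ^ p ^ a` with `S ^ p ^ a = S`. Frobenius gives `(A - S) ^ p ^
-- a = 0`, and whatever commutes with `A` commutes with its power `S`.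
open Polynomial in
theorem extendsToStabilizer {R : Type*} {k : Type*} [CommRing R] [Field k] [Finite k] {r : R →+* k}
    {ϖ : R} (h : IsLengthTwo r ϖ) {n : Type*} [Fintype n] [DecidableEq n] (ψ : AddChar k ℂ)
    (A : Matrix n n k) : ExtendsToStabilizer r ϖ ψ A := by
  have := h.finite
  cases isEmpty_or_nonempty n with
  | inl hn =>
    -- With no indices the matrix ring is zero and does not have characteristic `p`, so this case is
    -- separate.
    rw [Subsingleton.elim A (diagonal 0)]
    exact .diagonal h ψ 0
  | inr hn =>
    obtain ⟨p, hp⟩ := CharP.exists k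
    have hprime : Fact p.Prime := ⟨CharP.char_is_prime k p⟩
    obtain ⟨a, ha, hS⟩ := exists_pow_expChar_pow_eq p A
    obtain ⟨S, hSA⟩ : ∃ S, S = A ^ p ^ a := ⟨_, rfl⟩
    rw [← hSA] at hS
    have hcomm : Commute A S := hSA ▸ (Commute.refl A).pow_right _
    have hN : IsNilpotent (A - S) := ⟨p ^ a, by
      rw [sub_pow_char_pow_of_commute _ _ hcomm, ← hSA, hS, sub_self]⟩
    have hEN : ExtendsToStabilizer r ϖ ψ (A - S) := by
      obtain ⟨P, f, hPf⟩ := (A - S).exists_toMatrix_of_isNilpotent hN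
      refine .of_conj h P hPf (.toMatrix h ψ f ?_)
      obtain ⟨m, hm⟩ := hN
      have h1 := (show SemiconjBy (P : Matrix n n k) (A - S) f.toMatrix from hPf).pow_right m
      rw [SemiconjBy, hm, mul_zero] at h1
      exact ⟨m, (Units.mul_left_eq_zero P).1 h1.symm⟩
    have hES : ExtendsToStabilizer r ϖ ψ S := by
      -- The eigenvalues of `S` are roots of this separable polynomial but may lie outside `k`.
      let g : k[X] := X ^ p ^ a - X
      obtain ⟨F, r', h', hr'⟩ := h.exists_baseChange g.SplittingField
      have : Finite g.SplittingField := Module.finite_of_finite k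
      have := h'.finite
      obtain ⟨ψ', hψ'⟩ := AddChar.exists_comp_eq_of_injective
        (algebraMap k g.SplittingField).toAddMonoidHom (algebraMap k g.SplittingField).injective ψ
      refine .of_baseChange (AdjoinRoot.of F) (algebraMap k g.SplittingField) hr' hψ' ?_
      have : CharP g.SplittingField p := charP_of_injective_algebraMap' k p
      have hpa : 1 < p ^ a := Nat.one_lt_pow ha.ne' hprime.out.one_lt
      have hsplit := SplittingField.splits g
      simp only [g, Polynomial.map_sub, Polynomial.map_pow, map_X] at hsplit
      obtain ⟨P, c, hPc⟩ := Matrix.exists_diagonal_of_pow_eq hpa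
        (galois_poly_separable p (p ^ a) (dvd_pow_self p ha.ne')) hsplit
        ((algebraMap k g.SplittingField).mapMatrix S) (by rw [← map_pow, hS])
      exact .of_conj h' P hPc (.diagonal h' ψ' c)
    have := hES.add hEN fun X hX => by
      rw [add_sub_cancel] at hX
      exact hSA ▸ hX.pow_right _
    rwa [add_sub_cancel] at this

/-! ### Cocycles, and group algebras as groupoid algebras -/

section Cocycle

variable {G Q X : Type*} [Group G] [Group Q] [MulAction Q X]

/-- Multiplicative functions on the stabilizers which agree with a family `ψ` of functions,
equivariant under conjugation, on the kernel of `π : G → Q` assemble to a `1`-cocycle. -/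
theorem exists_cocycle (π : G →* Q) (hπ : Function.Surjective π) (ψ : X → G → ℂ)
    (hψ : ∀ g x u, π u = 1 → ψ (π g • x) (g * u * g⁻¹) = ψ x u)
    (hχ : ∀ x, ∃ χ : G → ℂ, (∀ g h, π g • x = x → π h • x = x → χ (g * h) = χ g * χ h) ∧
      ∀ u, π u = 1 → χ u = ψ x u) :
    ∃ φ : G → X → ℂ, (∀ g h x, φ (g * h) x = φ g (π h • x) * φ h x) ∧
      ∀ u x, π u = 1 → φ u x = ψ x u := by
  choose χ hmul hker using hχ
  let ρ : X → X := fun x => (Quotient.mk (MulAction.orbitRel Q X) x).out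
  have hρ : ∀ (q : Q) x, ρ (q • x) = ρ x := fun q x => by
    have : Quotient.mk (MulAction.orbitRel Q X) (q • x) = Quotient.mk _ x :=
      Quotient.sound ⟨q, rfl⟩
    simp only [ρ, this]
  have hs : ∀ x, ∃ g : G, π g • ρ x = x := fun x => by
    have h1 : (MulAction.orbitRel Q X).r (ρ x) x := Quotient.exact (Quotient.out_eq _)
    obtain ⟨q, hq⟩ := (MulAction.orbitRel Q X).symm h1
    obtain ⟨g, rfl⟩ := hπ q
    exact ⟨g, hq⟩
  choose s hs using hs
  have hs' : ∀ x, (π (s x))⁻¹ • x = ρ x := fun x => by rw [inv_smul_eq_iff, hs]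
  have hstab : ∀ g x, π ((s (π g • x))⁻¹ * g * s x) • ρ x = ρ x := fun g x => by
    rw [map_mul, map_mul, mul_smul, mul_smul, hs, map_inv, hs', hρ]
  -- With `s x` carrying the orbit representative `ρ x` to `x`, the element `(s (g x))⁻¹ g (s x)`
  -- stabilizes `ρ x`, and these elements compose along the groupoid.
  refine ⟨fun g x => χ (ρ x) ((s (π g • x))⁻¹ * g * s x), fun g h x => ?_, fun u x hu => ?_⟩
  · beta_reduce
    have h1 := hstab g (π h • x)
    rw [hρ] at h1
    rw [hρ, ← hmul _ _ _ h1 (hstab h x), map_mul, mul_smul]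
    congr 1
    group
  · beta_reduce
    rw [hu, one_smul, hker, ← hψ (s x) (ρ x), hs]
    · congr 1
      group
    · simp [hu]
    · simp [hu]

open MonoidAlgebra

/-- Idempotents `e x` of the group algebra, permuted by `G` through `π`, on which the kernel of
`π` acts by scalars, together with a cocycle `φ` extending these scalars. -/
structure IsMonomialSystem [Fintype X] [DecidableEq X] {ι : Type*} [Fintype ι] (π : G →* Q)
    (φ : G → X → ℂ) (κ : ι → G) (c : X → ι → ℂ) (e : X → MonoidAlgebra ℂ G) : Prop where
  surjective : Function.Surjective π
  cocycle : ∀ g h x, φ (g * h) x = φ g (π h • x) * φ h x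
  cocycle_one : ∀ x, φ 1 x = 1
  of_mul : ∀ g x, of ℂ G g * e x = e (π g • x) * of ℂ G g
  of_mul_of_ker : ∀ u x, π u = 1 → of ℂ G u * e x = φ u x • e x
  sum_eq : ∑ x, e x = 1
  ker : ∀ i, π (κ i) = 1
  eq_sum : ∀ x, e x = ∑ i, c x i • of ℂ G (κ i)
  orthogonal : ∀ x y, ∑ i, c x i * φ (κ i) y = if x = y then 1 else 0

namespace IsMonomialSystem

variable [Fintype X] [DecidableEq X] {ι : Type*} [Fintype ι] {π : G →* Q} {φ : G → X → ℂ}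
  {κ : ι → G} {c : X → ι → ℂ} {e : X → MonoidAlgebra ℂ G}

theorem ne_zero (h : IsMonomialSystem π φ κ c e) (g : G) (x : X) : φ g x ≠ 0 := by
  have h1 := h.cocycle g⁻¹ g x
  rw [inv_mul_cancel, h.cocycle_one] at h1
  exact right_ne_zero_of_mul (h1 ▸ one_ne_zero)

theorem mul_self (h : IsMonomialSystem π φ κ c e) (x y : X) :
    e x * e y = if x = y then e y else 0 := by
  nth_rw 1 [h.eq_sum x]
  rw [Finset.sum_mul]
  simp only [smul_mul_assoc, h.of_mul_of_ker _ _ (h.ker _), smul_smul]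
  rw [← Finset.sum_smul, h.orthogonal]
  split_ifs <;> simp

/-- The matrix units `φ g x ⁻¹ • g e x`, where `π g = q`. -/
noncomputable def unit (h : IsMonomialSystem π φ κ c e) (q : Q) (x : X) : MonoidAlgebra ℂ G :=
  (φ (Function.surjInv h.surjective q) x)⁻¹ • (of ℂ G (Function.surjInv h.surjective q) * e x)

/-- Two elements with the same image in `Q` differ by a kernel element, which acts on `e x` by a
scalar that `φ` also records. Hence `unit` is independent of the chosen lift. -/
theorem of_mul_eq (h : IsMonomialSystem π φ κ c e) (g : G) (x : X) :
    of ℂ G g * e x = φ g x • h.unit (π g) x := by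
  obtain ⟨t, ht⟩ : ∃ t, t = Function.surjInv h.surjective (π g) := ⟨_, rfl⟩
  have hπt : π t = π g := by rw [ht, Function.surjInv_eq h.surjective]
  have hu : π (t⁻¹ * g) = 1 := by rw [map_mul, map_inv, hπt, inv_mul_cancel]
  rw [unit, ← ht, smul_smul]
  have h1 : φ g x = φ t x * φ (t⁻¹ * g) x := by
    have := h.cocycle t (t⁻¹ * g) x
    rwa [mul_inv_cancel_left, hu, one_smul] at this
  have h2 : of ℂ G g * e x = φ (t⁻¹ * g) x • (of ℂ G t * e x) := by
    rw [← mul_smul_comm, ← h.of_mul_of_ker _ _ hu, ← mul_assoc, ← map_mul, mul_inv_cancel_left]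
  rw [h2, h1, mul_right_comm, mul_inv_cancel₀ (h.ne_zero t x), one_mul]

theorem unit_eq (h : IsMonomialSystem π φ κ c e) (g : G) (x : X) :
    h.unit (π g) x = (φ g x)⁻¹ • (of ℂ G g * e x) := by
  rw [h.of_mul_eq, smul_smul, inv_mul_cancel₀ (h.ne_zero g x), one_smul]

theorem unit_one (h : IsMonomialSystem π φ κ c e) (x : X) : h.unit 1 x = e x := by
  rw [← map_one π, h.unit_eq, h.cocycle_one, inv_one, one_smul, map_one, one_mul]

/-- The multiplication table mentions only the action of `Q` on `X`: the cocycle has cancelled. -/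
theorem unit_mul_unit (h : IsMonomialSystem π φ κ c e) (p q : Q) (x y : X) :
    h.unit p y * h.unit q x = if y = q • x then h.unit (p * q) x else 0 := by
  obtain ⟨g, rfl⟩ := h.surjective p
  obtain ⟨g', rfl⟩ := h.surjective q
  rw [← map_mul, h.unit_eq, h.unit_eq, smul_mul_smul_comm, mul_assoc, h.of_mul g', ← mul_assoc (e y), h.mul_self]
  split_ifs with hy
  · rw [← h.of_mul, ← mul_assoc (of ℂ G g), ← map_mul, h.unit_eq, h.cocycle, hy, mul_inv]
  · simp

theorem of_eq_sum (h : IsMonomialSystem π φ κ c e) (g : G) :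
    of ℂ G g = ∑ x, φ g x • h.unit (π g) x := by
  simp only [← h.of_mul_eq, ← Finset.mul_sum, h.sum_eq, mul_one]

variable {G' : Type*} [Group G'] {ι' : Type*} [Fintype ι'] {π' : G' →* Q} {φ' : G' → X → ℂ}
  {κ' : ι' → G'} {c' : X → ι' → ℂ} {e' : X → MonoidAlgebra ℂ G'}

/-- The algebra homomorphism matching the matrix units of two monomial systems. -/
noncomputable def algHom (h : IsMonomialSystem π φ κ c e) (h' : IsMonomialSystem π' φ' κ' c' e') :
    MonoidAlgebra ℂ G →ₐ[ℂ] MonoidAlgebra ℂ G' :=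
  MonoidAlgebra.lift ℂ (MonoidAlgebra ℂ G') G
    { toFun := fun g => ∑ x, φ g x • h'.unit (π g) x
      map_one' := by simp [h.cocycle_one, h'.unit_one, h'.sum_eq]
      map_mul' := fun g g' => by
        simp only [Finset.sum_mul_sum, smul_mul_smul_comm, h'.unit_mul_unit]
        rw [Finset.sum_comm]
        refine Finset.sum_congr rfl fun x _ => ?_
        simp [h.cocycle] }

theorem algHom_of (h : IsMonomialSystem π φ κ c e) (h' : IsMonomialSystem π' φ' κ' c' e') (g : G) :
    h.algHom h' (of ℂ G g) = ∑ x, φ g x • h'.unit (π g) x := by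
  simp [algHom]

/-- Each `e x` is a combination of kernel elements, whose images are diagonal in the idempotents `e'
y`; orthogonality leaves only `y = x`. -/
theorem algHom_apply_idempotent (h : IsMonomialSystem π φ κ c e)
    (h' : IsMonomialSystem π' φ' κ' c' e') (x : X) : h.algHom h' (e x) = e' x := by
  rw [h.eq_sum, map_sum]
  simp only [map_smul, algHom_of, h.ker, h'.unit_one, Finset.smul_sum, smul_smul]
  rw [Finset.sum_comm]
  simp only [← Finset.sum_smul, h.orthogonal]
  simp

theorem algHom_unit (h : IsMonomialSystem π φ κ c e)
    (h' : IsMonomialSystem π' φ' κ' c' e') (q : Q) (x : X) :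
    h.algHom h' (h.unit q x) = h'.unit q x := by
  obtain ⟨g, rfl⟩ := h.surjective q
  rw [h.unit_eq, map_smul, map_mul, algHom_apply_idempotent, algHom_of, Finset.sum_mul]
  simp only [← h'.unit_one, smul_mul_assoc, h'.unit_mul_unit]
  simp [h.ne_zero]

theorem algHom_comp_algHom (h : IsMonomialSystem π φ κ c e)
    (h' : IsMonomialSystem π' φ' κ' c' e') :
    (h'.algHom h).comp (h.algHom h') = AlgHom.id ℂ (MonoidAlgebra ℂ G) := by
  refine MonoidAlgebra.algHom_ext (fun g => ?_) (Subsingleton.elim _ _)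
  change h'.algHom h (h.algHom h' (of ℂ G g)) = of ℂ G g
  rw [algHom_of, map_sum, h.of_eq_sum]
  simp only [map_smul, algHom_unit]

/-- Group algebras with monomial systems over the same `Q`-set are isomorphic. -/
noncomputable def algEquiv (h : IsMonomialSystem π φ κ c e)
    (h' : IsMonomialSystem π' φ' κ' c' e') : MonoidAlgebra ℂ G ≃ₐ[ℂ] MonoidAlgebra ℂ G' :=
  AlgEquiv.ofAlgHom (h.algHom h') (h'.algHom h) (h'.algHom_comp_algHom h) (h.algHom_comp_algHom h')

end IsMonomialSystem

end Cocycle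

/-! ### The monomial system of `GL n R` -/

section GeneralLinear

open MonoidAlgebra

variable {R k : Type*} [CommRing R] [Field k] {r : R →+* k} {ϖ : R}
  {n : Type*} [Fintype n] [DecidableEq n]

/-- The reduction `GL n R → GL n k`, the target acting on matrices by conjugation. -/
def conjReduction (n : Type*) [Fintype n] [DecidableEq n] (r : R →+* k) :
    GL n R →* ConjAct (GL n k) :=
  (ConjAct.toConjAct (G := GL n k)).toMonoidHom.comp (GeneralLinearGroup.map r)

theorem conjReduction_smul (g : GL n R) (A : Matrix n n k) :
    conjReduction n r g • A = r.mapMatrix (g : Matrix n n R) * A *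
      r.mapMatrix ((g⁻¹ : GL n R) : Matrix n n R) := by
  rw [ConjAct.units_smul_def]
  simp only [conjReduction, MonoidHom.comp_apply, MulEquiv.coe_toMonoidHom,
    ConjAct.ofConjAct_toConjAct, ← map_inv]
  rfl

theorem conjReduction_smul_eq_iff (g : GL n R) (A : Matrix n n k) :
    conjReduction n r g • A = A ↔ Commute (r.mapMatrix (g : Matrix n n R)) A := by
  have h1 : r.mapMatrix ((g⁻¹ : GL n R) : Matrix n n R) * r.mapMatrix (g : Matrix n n R) = 1 := by
    rw [← map_mul, Units.inv_mul, map_one]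
  have h2 : r.mapMatrix (g : Matrix n n R) * r.mapMatrix ((g⁻¹ : GL n R) : Matrix n n R) = 1 := by
    rw [← map_mul, Units.mul_inv, map_one]
  rw [conjReduction_smul, Commute, SemiconjBy]
  constructor
  · intro h
    nth_rw 2 [← h]
    rw [mul_assoc _ _ (r.mapMatrix (g : Matrix n n R)), h1, mul_one]
  · intro h
    rw [h, mul_assoc, h2, mul_one]

theorem conjReduction_eq_one_iff (g : GL n R) :
    conjReduction n r g = 1 ↔ r.mapMatrix (g : Matrix n n R) = 1 := by
  rw [conjReduction, MonoidHom.comp_apply, MulEquiv.coe_toMonoidHom, EmbeddingLike.map_eq_one_iff,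
    ← Units.val_inj]
  rfl

theorem IsLengthTwo.conjReduction_surjective (h : IsLengthTwo r ϖ) :
    Function.Surjective (conjReduction n r) := by
  intro q
  obtain ⟨g, hg⟩ := h.exists_general_linear_lift (ConjAct.ofConjAct q)
  exact ⟨g, congrArg ConjAct.toConjAct (Units.ext hg)⟩

/-- The isomorphism of `Matrix n n k` onto the congruence kernel. -/
theorem IsLengthTwo.exists_kernel_param (h : IsLengthTwo r ϖ) :
    ∃ κ : Matrix n n k → GL n R,
      (∀ Y : Matrix n n R, (κ (r.mapMatrix Y) : Matrix n n R) = 1 + ϖ • Y) ∧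
      (∀ X X', κ (X + X') = κ X * κ X') ∧ κ 0 = 1 ∧
      (∀ g, conjReduction n r g = 1 ↔ ∃ X, κ X = g) ∧
      ∀ g X, g * κ X * g⁻¹ = κ (conjReduction n r g • X) := by
  choose t ht using h.mapMatrix_surjective (n := n)
  choose κ hκ using fun X => h.exists_general_linear_one_add (t X)
  have hκ' : ∀ Y : Matrix n n R, (κ (r.mapMatrix Y) : Matrix n n R) = 1 + ϖ • Y := fun Y => by
    rw [hκ, add_right_inj, h.smul_eq_smul_iff, ht]
  refine ⟨κ, hκ', fun X X' => Units.ext ?_, Units.ext ?_, fun g => ⟨fun hg => ?_, ?_⟩,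
    fun g X => Units.ext ?_⟩
  · obtain ⟨Y, rfl⟩ := h.mapMatrix_surjective X
    obtain ⟨Y', rfl⟩ := h.mapMatrix_surjective X'
    rw [← map_add, hκ', Units.val_mul, hκ', hκ', h.one_add_smul_mul]
  · rw [← map_zero r.mapMatrix, hκ', smul_zero, add_zero, Units.val_one]
  · rw [conjReduction_eq_one_iff] at hg
    obtain ⟨Y, hY⟩ := h.exists_eq_smul ((g : Matrix n n R) - 1) (by rw [map_sub, hg, map_one, sub_self])
    refine ⟨r.mapMatrix Y, Units.ext ?_⟩
    rw [hκ', ← hY, add_sub_cancel]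
  · rintro ⟨X, rfl⟩
    rw [conjReduction_eq_one_iff, hκ, map_add, h.mapMatrix_smul, map_one, add_zero]
  · obtain ⟨Y, rfl⟩ := h.mapMatrix_surjective X
    rw [conjReduction_smul, ← map_mul, ← map_mul, hκ', Units.val_mul, Units.val_mul, hκ', mul_add,
      add_mul, mul_one, Units.mul_inv, mul_smul_comm, smul_mul_assoc]

/-- Orthogonality of characters, combined with nondegeneracy of the trace form. -/
theorem sum_addChar_trace [Fintype k] [DecidableEq k] (ψ : AddChar k ℂ) (hψ : ψ ≠ 0) (A : Matrix n n k) :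
    ∑ X : Matrix n n k, ψ (A * X).trace =
      if A = 0 then (Fintype.card (Matrix n n k) : ℂ) else 0 := by
  classical
  have h1 := AddChar.sum_eq_ite (ψ.compAddMonoidHom
    ((traceAddMonoidHom n k).comp (AddMonoidHom.mulLeft A)))
  have h2 : ψ.compAddMonoidHom ((traceAddMonoidHom n k).comp (AddMonoidHom.mulLeft A)) = 0 ↔
      A = 0 := by
    constructor
    · intro h0
      by_contra hA
      obtain ⟨i, j, hij⟩ : ∃ i j, A i j ≠ 0 := by
        by_contra! h
        exact hA (Matrix.ext h)
      refine hψ (DFunLike.ext _ _ fun a => ?_)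
      have := DFunLike.congr_fun h0 (Matrix.single j i ((A i j)⁻¹ * a))
      simpa [Matrix.trace_mul_single, hij] using this
    · rintro rfl
      ext X
      simp
  rw [← Fintype.sum_congr _ _ (fun X => rfl), if_congr h2.symm rfl rfl, ← h1]
  rfl

theorem IsLengthTwo.exists_isMonomialSystem (h : IsLengthTwo r ϖ) [Fintype k] [DecidableEq k]
    (ψ : AddChar k ℂ) (hψ : ψ ≠ 0) :
    ∃ (φ : GL n R → Matrix n n k → ℂ) (κ : Matrix n n k → GL n R)
      (c : Matrix n n k → Matrix n n k → ℂ) (e : Matrix n n k → MonoidAlgebra ℂ (GL n R)),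
      IsMonomialSystem (conjReduction n r) φ κ c e := by
  obtain ⟨κ, hκ, hκadd, hκ0, hker, hconj⟩ := h.exists_kernel_param (n := n)
  have hκinj : Function.Injective κ := fun X X' hX => by
    obtain ⟨Y, rfl⟩ := h.mapMatrix_surjective X
    obtain ⟨Y', rfl⟩ := h.mapMatrix_surjective X'
    have := congrArg Units.val hX
    rw [hκ, hκ, add_right_inj] at this
    exact (h.smul_eq_smul_iff _ _).1 this
  have hinv : ∀ X, Function.invFun κ (κ X) = X := Function.leftInverse_invFun hκinj
  have htr : ∀ (g : GL n R) (A X : Matrix n n k), ((conjReduction n r g • A) * (conjReduction n r g • X)).trace =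
      (A * X).trace := by
    intro g A X
    have h1 : r.mapMatrix ((g⁻¹ : GL n R) : Matrix n n R) * r.mapMatrix (g : Matrix n n R) = 1 := by
      rw [← map_mul, Units.inv_mul, map_one]
    rw [conjReduction_smul, conjReduction_smul, mul_assoc, ← mul_assoc _ (_ * X), ← mul_assoc _ _ X,
      h1, one_mul, ← mul_assoc, Matrix.trace_mul_comm, ← mul_assoc, ← mul_assoc, h1, one_mul]
  obtain ⟨φ, hφ, hφker⟩ := exists_cocycle (conjReduction n r) h.conjReduction_surjective
    (fun A g => ψ (A * Function.invFun κ g).trace) (fun g A u hu => by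
      obtain ⟨X, rfl⟩ := (hker u).1 hu
      rw [hconj, hinv, hinv, htr]) (fun A => by
      obtain ⟨χ, hmul, hχ⟩ := extendsToStabilizer h ψ A
      refine ⟨χ, fun g g' hg hg' => hmul g g' ((conjReduction_smul_eq_iff g A).1 hg)
        ((conjReduction_smul_eq_iff g' A).1 hg'), fun u hu => ?_⟩
      obtain ⟨X, rfl⟩ := (hker u).1 hu
      obtain ⟨Y, rfl⟩ := h.mapMatrix_surjective X
      rw [hχ _ Y (hκ Y), hinv])
  have hφκ : ∀ X A, φ (κ X) A = ψ (A * X).trace := fun X A => by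
    rw [hφker _ _ ((hker _).2 ⟨X, rfl⟩), hinv]
  let N : ℂ := Fintype.card (Matrix n n k)
  have hN : N ≠ 0 := Nat.cast_ne_zero.2 Fintype.card_ne_zero
  -- Fourier idempotents of the abelian congruence kernel.
  refine ⟨φ, κ, fun A X => N⁻¹ * ψ (-(A * X).trace),
    fun A => ∑ X, (N⁻¹ * ψ (-(A * X).trace)) • of ℂ _ (κ X),
    { surjective := h.conjReduction_surjective
      cocycle := hφ
      cocycle_one := fun A => by simp [← hκ0, hφκ]
      of_mul := fun g A => ?_
      of_mul_of_ker := fun u A hu => ?_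
      sum_eq := ?_
      ker := fun X => (hker _).2 ⟨X, rfl⟩
      eq_sum := fun A => rfl
      orthogonal := fun A B => ?_ }⟩
  · rw [Finset.mul_sum, Finset.sum_mul]
    refine Fintype.sum_equiv (MulAction.toPerm (conjReduction n r g)) _ _ fun X => ?_
    rw [MulAction.toPerm_apply, htr, mul_smul_comm, smul_mul_assoc, ← map_mul, ← map_mul, ← hconj,
      inv_mul_cancel_right]
  · obtain ⟨Z, rfl⟩ := (hker u).1 hu
    rw [Finset.mul_sum, Finset.smul_sum, hφκ]
    refine Fintype.sum_equiv (Equiv.addLeft Z) _ _ fun X => ?_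
    rw [Equiv.coe_addLeft, mul_smul_comm, ← map_mul, ← hκadd, smul_smul, mul_left_comm,
      ← AddChar.map_add_eq_mul, mul_add, trace_add]
    congr 3
    ring
  · rw [Finset.sum_comm]
    simp only [← Finset.sum_smul, ← Finset.mul_sum]
    have : ∀ X : Matrix n n k, ∑ A : Matrix n n k, ψ (-(A * X).trace) = if X = 0 then N else 0 := by
      intro X
      rw [← if_congr (neg_eq_zero (a := X)) rfl rfl, ← sum_addChar_trace ψ hψ]
      refine Finset.sum_congr rfl fun A _ => ?_
      rw [neg_mul, trace_neg, Matrix.trace_mul_comm]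
    simp only [this]
    rw [Finset.sum_eq_single 0]
    · simp [hN, hκ0, one_def]
    · intro X _ hX
      simp [hX]
    · simp
  · simp only [hφκ, mul_assoc, ← Finset.mul_sum]
    have : ∀ X : Matrix n n k, ψ (-(A * X).trace) * ψ (B * X).trace = ψ ((B - A) * X).trace := by
      intro X
      rw [← AddChar.map_add_eq_mul, sub_mul, trace_sub]
      congr 1
      ring
    simp only [this]
    rw [sum_addChar_trace ψ hψ]
    by_cases hAB : A = B
    · simp [hAB, N]
    · simp [hAB, sub_eq_zero, Ne.symm hAB]

/-- The group algebra of `GL n R` for a ring `R` of length two depends only on the residue field. -/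
theorem nonempty_algEquiv_generalLinear [Finite k] {R' : Type*} [CommRing R'] {r' : R' →+* k}
    {ϖ' : R'} (h : IsLengthTwo r ϖ) (h' : IsLengthTwo r' ϖ') :
    Nonempty (MonoidAlgebra ℂ (GL n R) ≃ₐ[ℂ] MonoidAlgebra ℂ (GL n R')) := by
  classical
  have := Fintype.ofFinite k
  obtain ⟨ψ, hψ⟩ := (AddChar.exists_apply_ne_zero (a := (1 : k))).2 one_ne_zero
  have hψ0 : ψ ≠ 0 := by rintro rfl; simp at hψ
  obtain ⟨_, _, _, _, hs⟩ := h.exists_isMonomialSystem (n := n) ψ hψ0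
  obtain ⟨_, _, _, _, hs'⟩ := h'.exists_isMonomialSystem (n := n) ψ hψ0
  exact ⟨hs.algEquiv hs'⟩

end GeneralLinear

end

/-! ### Irreducible representations are determined by the group algebra -/

section Irreducible

open MonoidAlgebra

variable {G H : Type*} [Group G] [Group H] {V W : Type*} [AddCommGroup V] [Module ℂ V]
  [AddCommGroup W] [Module ℂ W]

theorem Subrepresentation.asAlgebraHom_mem {ρ : Representation ℂ G V} (U : Subrepresentation ρ)
    (a : MonoidAlgebra ℂ G) {v : V} (hv : v ∈ U.toSubmodule) :
    ρ.asAlgebraHom a v ∈ U.toSubmodule := by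
  induction a using MonoidAlgebra.induction_linear with
  | zero => simp
  | add a b ha hb => simpa using add_mem ha hb
  | single g z => simpa using U.toSubmodule.smul_mem z (U.apply_mem_toSubmodule g hv)

/-- The representation of `H` on the space of `ρ` through a homomorphism of group algebras. -/
noncomputable def Representation.pullback (f : MonoidAlgebra ℂ H →ₐ[ℂ] MonoidAlgebra ℂ G)
    (ρ : Representation ℂ G V) : Representation ℂ H V :=
  ((ρ.asAlgebraHom.comp f : MonoidAlgebra ℂ H →ₐ[ℂ] Module.End ℂ V) :
    MonoidAlgebra ℂ H →* Module.End ℂ V).comp (of ℂ H)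

theorem Representation.asAlgebraHom_pullback (f : MonoidAlgebra ℂ H →ₐ[ℂ] MonoidAlgebra ℂ G)
    (ρ : Representation ℂ G V) (a : MonoidAlgebra ℂ H) :
    (ρ.pullback f).asAlgebraHom a = ρ.asAlgebraHom (f a) := by
  have : (ρ.pullback f).asAlgebraHom = ρ.asAlgebraHom.comp f :=
    MonoidAlgebra.algHom_ext (fun x => by
      rw [Representation.asAlgebraHom_single_one]; rfl) (Subsingleton.elim _ _)
  rw [this]; rfl

/-- Subrepresentations are the subspaces stable under the group algebra, so both sides have the same
ones. -/
theorem Representation.isIrreducible_pullback (f : MonoidAlgebra ℂ H ≃ₐ[ℂ] MonoidAlgebra ℂ G)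
    (ρ : Representation ℂ G V) (hρ : ρ.IsIrreducible) :
    (ρ.pullback (f : MonoidAlgebra ℂ H →ₐ[ℂ] MonoidAlgebra ℂ G)).IsIrreducible := by
  let E : Subrepresentation (ρ.pullback (f : MonoidAlgebra ℂ H →ₐ[ℂ] MonoidAlgebra ℂ G)) ≃o
      Subrepresentation ρ :=
    { toFun := fun U => ⟨U.toSubmodule, fun g v hv => by
        have := U.asAlgebraHom_mem (f.symm (of ℂ G g)) hv
        rw [Representation.asAlgebraHom_pullback, AlgEquiv.coe_toAlgHom, AlgEquiv.apply_symm_apply,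
          Representation.asAlgebraHom_of] at this
        exact this⟩
      invFun := fun U => ⟨U.toSubmodule, fun x v hv => U.asAlgebraHom_mem _ hv⟩
      left_inv := fun U => rfl
      right_inv := fun U => rfl
      map_rel_iff' := Iff.rfl }
  exact E.isSimpleOrder_iff.2 hρ

theorem Representation.Equiv.asAlgebraHom_apply {ρ : Representation ℂ G V}
    {σ : Representation ℂ G W} (φ : ρ.Equiv σ) (a : MonoidAlgebra ℂ G) (v : V) :
    φ (ρ.asAlgebraHom a v) = σ.asAlgebraHom a (φ v) := by
  induction a using MonoidAlgebra.induction_linear with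
  | zero => simp
  | add a b ha hb => simp [ha, hb]
  | single g z =>
    simp only [Representation.asAlgebraHom_single, LinearMap.smul_apply, map_smul]
    congr 1
    exact LinearMap.congr_fun (φ.isIntertwining' g) v

/-- Transport of irreducible representations along an isomorphism of group algebras. -/
noncomputable def ComplexIrrep.pullback (f : MonoidAlgebra ℂ H ≃ₐ[ℂ] MonoidAlgebra ℂ G)
    (π : ComplexIrrep G) : ComplexIrrep H where
  V := π.V
  ρ := π.ρ.pullback (f : MonoidAlgebra ℂ H →ₐ[ℂ] MonoidAlgebra ℂ G)
  irreducible := π.ρ.isIrreducible_pullback f π.irreducible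

/-- The map `Irr G → Irr H` induced by an isomorphism of group algebras. -/
noncomputable def Irr.pullback (f : MonoidAlgebra ℂ H ≃ₐ[ℂ] MonoidAlgebra ℂ G) :
    Irr G → Irr H :=
  Quotient.map (ComplexIrrep.pullback f) fun π σ ⟨φ⟩ =>
    ⟨Representation.Equiv.mk (ρ := (π.pullback f).ρ) (σ := (σ.pullback f).ρ) φ.toLinearEquiv
      fun x => LinearMap.ext fun v => φ.asAlgebraHom_apply (f (of ℂ H x)) v⟩

theorem Irr.pullback_pullback (f : MonoidAlgebra ℂ H ≃ₐ[ℂ] MonoidAlgebra ℂ G) (π : Irr G) :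
    (π.pullback f).pullback f.symm = π := by
  induction π using Quotient.inductionOn with
  | h π =>
    refine Quotient.sound ⟨Representation.Equiv.mk
      (ρ := ((π.pullback f).pullback f.symm).ρ) (σ := π.ρ)
      (LinearEquiv.refl ℂ π.V) fun x => LinearMap.ext fun v => ?_⟩
    change (π.ρ.pullback (f : MonoidAlgebra ℂ H →ₐ[ℂ] MonoidAlgebra ℂ G)).asAlgebraHom
      (f.symm (of ℂ G x)) v = π.ρ x v
    rw [Representation.asAlgebraHom_pullback, AlgEquiv.coe_toAlgHom, AlgEquiv.apply_symm_apply,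
      Representation.asAlgebraHom_of]

theorem Irr.dim_pullback (f : MonoidAlgebra ℂ H ≃ₐ[ℂ] MonoidAlgebra ℂ G) (π : Irr G) :
    (π.pullback f).dim = π.dim := by
  induction π using Quotient.inductionOn with
  | h π => rfl

/-- Isomorphic group algebras have the same irreducible representations. -/
noncomputable def Irr.congr (f : MonoidAlgebra ℂ H ≃ₐ[ℂ] MonoidAlgebra ℂ G) : Irr G ≃ Irr H where
  toFun := Irr.pullback f
  invFun := Irr.pullback f.symm
  left_inv := Irr.pullback_pullback f
  right_inv := Irr.pullback_pullback f.symm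

theorem Representation.nonempty_equiv_of_asModule {ρ : Representation ℂ G V}
    {σ : Representation ℂ G W} (e : ρ.asModule ≃ₗ[MonoidAlgebra ℂ G] σ.asModule) :
    Nonempty (ρ.Equiv σ) := by
  let f := (Representation.IntertwiningMap.equivLinearMapAsModule ρ σ).symm e.toLinearMap
  have hf : Function.Bijective f := e.bijective
  exact ⟨Representation.IntertwiningMap.ofBijective f hf⟩

/-- Every irreducible embeds as a simple left ideal in the semisimple group algebra, and its
isotypic component there determines its class; there are finitely many such components. -/
instance Irr.finite [Finite G] : Finite (Irr G) := by
  have := Fintype.ofFinite G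
  let R := MonoidAlgebra ℂ G
  have hI : ∀ π : ComplexIrrep G, ∃ I : Ideal R, Nonempty (π.ρ.asModule ≃ₗ[R] I) := fun π => by
    have : IsSimpleModule R π.ρ.asModule :=
      (Representation.irreducible_iff_isSimpleModule_asModule π.ρ).1 π.irreducible
    exact IsSemisimpleRing.exists_linearEquiv_ideal_of_isSimpleModule R π.ρ.asModule
  choose I e using hI
  have hsimple : ∀ π, IsSimpleModule R (I π) := fun π => by
    have : IsSimpleModule R π.ρ.asModule :=
      (Representation.irreducible_iff_isSimpleModule_asModule π.ρ).1 π.irreducible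
    exact IsSimpleModule.congr (e π).some.symm
  have : IsNoetherianRing R := inferInstance
  refine Finite.of_injective (fun π : Irr G => (⟨isotypicComponent R R (I π.out), I π.out,
    hsimple _, rfl⟩ : isotypicComponents R R)) fun π σ h => ?_
  have h1 : isotypicComponent R R (I π.out) = isotypicComponent R R (I σ.out) :=
    congrArg Subtype.val h
  have := hsimple π.out
  have := hsimple σ.out
  obtain ⟨φ⟩ := isIsotypicOfType_submodule_iff.1 (.isotypicComponent R R (I σ.out)) (I π.out)
    (h1 ▸ (I π.out).le_isotypicComponent)
  rw [← Quotient.out_eq π, ← Quotient.out_eq σ]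
  exact Quotient.sound (Representation.nonempty_equiv_of_asModule
    (((e _).some.trans φ).trans (e _).some.symm))

end Irreducible

/-! ### Application to local fields -/

theorem IsDiscreteValuationRing.exists_isLengthTwo (A : Type*) [CommRing A] [IsDomain A]
    [IsDiscreteValuationRing A] :
    ∃ (r : A ⧸ (IsLocalRing.maximalIdeal A ^ 2) →+* IsLocalRing.ResidueField A)
      (ϖ : A ⧸ (IsLocalRing.maximalIdeal A ^ 2)), IsLengthTwo r ϖ := by
  obtain ⟨t, ht⟩ := IsDiscreteValuationRing.exists_irreducible A
  have hm : IsLocalRing.maximalIdeal A = Ideal.span {t} :=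
    (IsDiscreteValuationRing.irreducible_iff_uniformizer t).1 ht
  have hm2 : IsLocalRing.maximalIdeal A ^ 2 = Ideal.span {t ^ 2} := by
    rw [hm, Ideal.span_singleton_pow]
  have hle : ∀ a ∈ IsLocalRing.maximalIdeal A ^ 2, IsLocalRing.residue A a = 0 := fun a ha =>
    (IsLocalRing.residue_eq_zero_iff a).2 (Ideal.pow_le_self two_ne_zero ha)
  let r := Ideal.Quotient.lift (IsLocalRing.maximalIdeal A ^ 2) (IsLocalRing.residue A) hle
  have hr : ∀ a, r (Ideal.Quotient.mk _ a) = 0 ↔ t ∣ a := fun a => by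
    rw [Ideal.Quotient.lift_mk, IsLocalRing.residue_eq_zero_iff, hm, Ideal.mem_span_singleton]
  refine ⟨r, Ideal.Quotient.mk _ t, fun y => ?_, (hr t).2 dvd_rfl, fun x => ?_, fun x hx => ?_⟩
  · obtain ⟨a, rfl⟩ := IsLocalRing.residue_surjective y
    exact ⟨Ideal.Quotient.mk _ a, Ideal.Quotient.lift_mk _ _ _⟩
  · obtain ⟨a, rfl⟩ := Ideal.Quotient.mk_surjective x
    rw [← map_mul, Ideal.Quotient.eq_zero_iff_mem, hr, hm2, Ideal.mem_span_singleton, sq]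
    exact mul_dvd_mul_iff_left ht.ne_zero
  · obtain ⟨a, rfl⟩ := Ideal.Quotient.mk_surjective x
    obtain ⟨b, rfl⟩ := (hr a).1 hx
    exact ⟨Ideal.Quotient.mk _ b, map_mul _ _ _⟩

theorem IsLengthTwo.comp_ringEquiv {R k l : Type*} [CommRing R] [Field k] [Field l] {r : R →+* k}
    {ϖ : R} (h : IsLengthTwo r ϖ) (e : k ≃+* l) : IsLengthTwo ((e : k →+* l).comp r) ϖ where
  surjective := e.surjective.comp h.surjective
  map_eq_zero := by simp [h.map_eq_zero]
  mul_eq_zero_iff x := by simp [h.mul_eq_zero_iff]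
  exists_eq_mul x hx := h.exists_eq_mul x (by simpa using hx)

/-- Over a ring `B` onto which `A` surjects, `A`-linear and `B`-linear automorphisms agree. -/
def LinearEquiv.restrictScalarsMulEquiv {A B M : Type*} [CommRing A] [CommRing B] [Algebra A B]
    [AddCommGroup M] [Module A M] [Module B M] [IsScalarTower A B M]
    (h : Function.Surjective (algebraMap A B)) : (M ≃ₗ[B] M) ≃* (M ≃ₗ[A] M) where
  toFun := LinearEquiv.restrictScalars A
  invFun := LinearEquiv.extendScalarsOfSurjective h
  left_inv _ := rfl
  right_inv _ := rfl
  map_mul' _ _ := rfl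

/-- The automorphism group of the free `A / I`-module of rank `n`, as an `A`-module. -/
noncomputable def generalLinearMulEquivAut {A : Type*} [CommRing A] (I : Ideal A) (n : ℕ) :
    GL (Fin n) (A ⧸ I) ≃* ((Fin n → A ⧸ I) ≃ₗ[A] (Fin n → A ⧸ I)) :=
  (Matrix.GeneralLinearGroup.toLin.trans
    (LinearMap.GeneralLinearGroup.generalLinearEquiv (A ⧸ I) (Fin n → A ⧸ I))).trans
    (LinearEquiv.restrictScalarsMulEquiv Ideal.Quotient.mk_surjective)

theorem mainTheorem4
    (F : Type*) [Field F] [ValuativeRel F] [TopologicalSpace F] [IsNonarchimedeanLocalField F]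
    (F' : Type*) [Field F'] [ValuativeRel F'] [TopologicalSpace F'] [IsNonarchimedeanLocalField F']
    (hq : Nat.card 𝓀[F] = Nat.card 𝓀[F']) (n : ℕ) :
    -- the group algebras of the groups `GL_n(𝒪_2)` and `GL_n(𝒪'_2)` are isomorphic
    Nonempty (MonoidAlgebra ℂ (GL (Fin n) (TruncatedRing F 2)) ≃ₐ[ℂ]
        MonoidAlgebra ℂ (GL (Fin n) (TruncatedRing F' 2))) ∧
    -- the (finite) number and the dimensions of the irreducible representations agree
    (Finite (Irr (GL (Fin n) (TruncatedRing F 2))) ∧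
      Finite (Irr (GL (Fin n) (TruncatedRing F' 2))) ∧
      ∃ e : Irr (GL (Fin n) (TruncatedRing F 2)) ≃ Irr (GL (Fin n) (TruncatedRing F' 2)),
        ∀ π, (e π).dim = π.dim) ∧
    -- the group algebras of `G_λ` agree for `λ = (2, …, 2)` with `n` parts
    Nonempty (MonoidAlgebra ℂ (AutOfType F (fun _ : Fin n => 2)) ≃ₐ[ℂ]
        MonoidAlgebra ℂ (AutOfType F' (fun _ : Fin n => 2))) := by
  have := Fintype.ofFinite 𝓀[F]
  have := Fintype.ofFinite 𝓀[F']
  obtain ⟨r, ϖ, h⟩ := IsDiscreteValuationRing.exists_isLengthTwo 𝒪[F]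
  obtain ⟨r', ϖ', h'⟩ := IsDiscreteValuationRing.exists_isLengthTwo 𝒪[F']
  rw [Nat.card_eq_fintype_card, Nat.card_eq_fintype_card] at hq
  -- Finite fields of equal cardinality are isomorphic, so both reductions can be taken to land in
  -- the same field.
  have h'' := h'.comp_ringEquiv (FiniteField.ringEquivOfCardEq hq).symm
  have : Finite (TruncatedRing F 2) := h.finite
  have : Finite (TruncatedRing F' 2) := h'.finite
  obtain ⟨f⟩ := nonempty_algEquiv_generalLinear (n := Fin n) h h''
  refine ⟨⟨f⟩, ⟨inferInstance, inferInstance, Irr.congr f.symm, Irr.dim_pullback f.symm⟩, ⟨?_⟩⟩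
  exact ((MonoidAlgebra.domCongr ℂ ℂ (generalLinearMulEquivAut (𝓂[F] ^ 2) n)).symm.trans f).trans
    (MonoidAlgebra.domCongr ℂ ℂ (generalLinearMulEquivAut (𝓂[F'] ^ 2) n))
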